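/- **Multivariate Carleman condition for mixture models.** Let $n\in\mathbb N$, let $S\subset\mathbb R^p$ be compact (for example a compact basic semi-algebraic set), and let $(\mu_\theta)_{\theta\in S}$ be probability measures on $\mathbb R^n$, with $\theta\mapsto\mu_\theta(B)$ measurable for each Borel set $B$, from one of the following families. - *Gaussian:* $\theta=(m,\Sigma)$ consists of the entries of $m\in\mathbb R^n$ and the entries $\Sigma_{ij}$, $i\le j$, of a symmetric positive semidefinite matrix $\Sigma$, and $\mu_\theta=\mathcal N(m,\Sigma)$. - *Poisson:* $\theta=(\lambda_1,\dots,\lambda_n)\in\mathbb R_{>0}^n$ and the $i$-th marginal of $\mu_\theta$ is $\mathrm{Pois}(\lambda_i)$, $i=1,\dots,n$. - *Exponential:* $\theta=(\eta_1,\dots,\eta_n)\in\mathbb R_{>0}^n$ and the $i$-th marginal of $\mu_\theta$ is exponential with mean $\eta_i$ (rate $\lambda_i=1/\eta_i$), $i=1,\dots,n$. Define $e_{i,k}(\theta)$ and $g(k)$, for $k\ge1$, as follows (with $(-1)!!=1$, and $S(\cdot,\cdot)$ the Stirling numbers of the second kind, so that the Poisson entry is the Touchard polynomial $T_{2k}(\lambda_i)$):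 - Gaussian: $e_{i,k}(\theta)=\sum_{l=0}^{k}\binom{2k}{2l}m_i^{2k-2l}\,\Sigma_{ii}^{l}\,(2l-1)!!$ and $g(k)=\sqrt k$; - Poisson: $e_{i,k}(\theta)=\sum_{j=0}^{2k}S(2k,j)\lambda_i^{j}$ and $g(k)=k/\ln(2k+1)$; - Exponential: $e_{i,k}(\theta)=(2k)!\,\eta_i^{2k}$ and $g(k)=k$. Then there are constants $C_1,\dots,C_n>0$, depending only on the family $(\mu_\theta)_{\theta\in S}$, such that the following hold. 1. For all $i\in\{1,\dots,n\}$, $k\ge1$ and $\theta\in S$, the function $x_i^{2k}$ is $\mu_\theta$-integrable and $$\int x_i^{2k}\,d\mu_\theta=e_{i,k}(\theta)\le (C_i\,g(k))^{2k}.$$ 2. Let $\phi$ be any Borel probability measure on $S$, let $\nu_\phi(B)=\int_S\mu_\theta(B)\,d\phi(\theta)$, and let $L_\phi$ be the Riesz functional of the moment sequence of $\phi$, that is $L_\phi(f)=\sum_\gamma f_\gamma\int_S\theta^\gamma d\phi(\theta)$ for a polynomial $f=\sum_\gamma f_\gamma\theta^\gamma$. Let $(p_\alpha)_{\alpha\in\mathbb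 N^n}$ be any real polynomials in $\theta$ with $\deg p_\alpha\le|\alpha|$ that represent the moments of $\nu_\phi$, i.e. $\int x^\alpha d\nu_\phi=\int_S p_\alpha(\theta)\,d\phi(\theta)$ for all $\alpha$. Then for each $i\in\{1,\dots,n\}$, with $\mathbf e_i$ the $i$-th unit vector in $\mathbb N^n$, one has $L_\phi(p_{2k\mathbf e_i})\le (C_i\,g(k))^{2k}$ for all $k\ge1$, and $$\sum_{k=1}^{\infty}\big(L_\phi(p_{2k\mathbf e_i})\big)^{-\frac1{2k}}=+\infty$$ (with the convention $0^{-1/2k}=+\infty$). 3. For every Borel probability measure $\phi$ on $S$, $\nu_\phi$ is moment-determinate: all its moments are finite, and it is the only Borel measure on $\mathbb R^n$ all of whose moments are finite and equal to those of $\nu_\phi$. -/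

import Mathlib

open MeasureTheory ProbabilityTheory
open scoped ENNReal

noncomputable section

namespace MixtureCarleman

/-- The three parametric families. -/
inductive Family where
  | gaussian
  | poisson
  | exponential

/-- Index set of the real parameters `θ` of a law on `ℝⁿ`: for a Gaussian, the `n` entries of the
mean and the `n(n+1)/2` entries `Σ i j`, `i ≤ j`, of the symmetric covariance matrix; for the
other two families one parameter per coordinate. -/
def Family.Index : Family → ℕ → Type
  | .gaussian, n => Fin n ⊕ {q : Fin n × Fin n // q.1 ≤ q.2}
  | .poisson, n => Fin n
  | .exponential, n => Fin n

/-- The mean vector encoded by a Gaussian parameter. -/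
def gaussMean {n : ℕ} (θ : Family.gaussian.Index n → ℝ) : EuclideanSpace ℝ (Fin n) :=
  WithLp.toLp 2 fun i => θ (Sum.inl i)

/-- The symmetric covariance matrix encoded by a Gaussian parameter. -/
def gaussCov {n : ℕ} (θ : Family.gaussian.Index n → ℝ) : Matrix (Fin n) (Fin n) ℝ :=
  Matrix.of fun i j => θ (Sum.inr ⟨(min i j, max i j), min_le_max⟩)

/-- `F.IsComponent θ μ`: `θ` is an admissible parameter and `μ` is a component law on `ℝⁿ` with
parameter `θ`.
* Gaussian: `θ = (m, Σ)` with `Σ` positive semidefinite and `μ = N(m, Σ)`.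
* Poisson: `θ = (λ₁, …, λₙ)` is positive and the `i`-th marginal of `μ` is `Pois(λᵢ)`.
* Exponential: `θ = (η₁, …, ηₙ)` is positive and the `i`-th marginal of `μ` is exponential with
  mean `ηᵢ`, that is with rate `1 / ηᵢ`.
In the last two cases the coordinates may be dependent. -/
def Family.IsComponent {n : ℕ} : (F : Family) → (F.Index n → ℝ) →
    Measure (EuclideanSpace ℝ (Fin n)) → Prop
  | .gaussian, θ, μ =>
      (gaussCov θ).PosSemidef ∧ μ = multivariateGaussian (gaussMean θ) (gaussCov θ)
  | .poisson, θ, μ => ∀ i : Fin n, 0 < θ i ∧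
      μ.map (fun x => x i) = (poissonMeasure (θ i).toNNReal).map (fun m : ℕ => (m : ℝ))
  | .exponential, θ, μ => ∀ i : Fin n, 0 < θ i ∧ μ.map (fun x => x i) = expMeasure (θ i)⁻¹

/-- The closed form of the moment of order `2k` of the `i`-th coordinate: the Gaussian moment, the
Touchard polynomial `T_{2k}(λᵢ)`, and `(2k)! ηᵢ^{2k}`. -/
def Family.evenMoment {n : ℕ} : (F : Family) → (F.Index n → ℝ) → Fin n → ℕ → ℝ
  | .gaussian, θ, i, k => ∑ l ∈ Finset.range (k + 1),
      ((2 * k).choose (2 * l) : ℝ) * gaussMean θ i ^ (2 * k - 2 * l) * gaussCov θ i i ^ l *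
        (Nat.doubleFactorial (2 * l - 1) : ℝ)
  | .poisson, θ, i, k => ∑ j ∈ Finset.range (2 * k + 1), (Nat.stirlingSecond (2 * k) j : ℝ) * θ i ^ j
  | .exponential, θ, i, k => (Nat.factorial (2 * k) : ℝ) * θ i ^ (2 * k)

/-- Growth rate of the `2k`-th root of the moments of order `2k`. -/
def Family.growth : Family → ℕ → ℝ
  | .gaussian, k => Real.sqrt k
  | .poisson, k => (k : ℝ) / Real.log (2 * k + 1)
  | .exponential, k => k

/-- The monomial `x^α = x₁^{α₁} ⋯ xₙ^{αₙ}`. -/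
def monom {n : ℕ} (α : Fin n →₀ ℕ) (x : EuclideanSpace ℝ (Fin n)) : ℝ := ∏ i, x i ^ α i

/-- A Borel measure on `ℝⁿ` has all its moments finite and is the only Borel measure with these
moments. -/
def MomentDeterminate {n : ℕ} (ν : Measure (EuclideanSpace ℝ (Fin n))) : Prop :=
  (∀ α, Integrable (monom α) ν) ∧
    ∀ ν' : Measure (EuclideanSpace ℝ (Fin n)), (∀ α, Integrable (monom α) ν') →
      (∀ α, ∫ x, monom α x ∂ν' = ∫ x, monom α x ∂ν) → ν' = ν

/-- The mixture `ν_φ` of the component laws `κ θ`, `θ ∈ S`, with mixing measure `φ`. -/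
def mixture {ι : Type} {n : ℕ} {S : Set (ι → ℝ)} (κ : Kernel S (EuclideanSpace ℝ (Fin n)))
    (φ : Measure S) : Measure (EuclideanSpace ℝ (Fin n)) :=
  φ.bind κ

theorem mixture_apply {ι : Type} {n : ℕ} {S : Set (ι → ℝ)}
    (κ : Kernel S (EuclideanSpace ℝ (Fin n))) (φ : Measure S)
    {B : Set (EuclideanSpace ℝ (Fin n))} (hB : MeasurableSet B) :
    mixture κ φ B = ∫⁻ θ, κ θ B ∂φ :=
  Measure.bind_apply hB κ.measurable.aemeasurable

/-- The Riesz functional `L_y(f) = ∑_γ f_γ y_γ` of a real sequence `y`. -/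
def riesz {ι : Type} (y : (ι →₀ ℕ) → ℝ) (f : MvPolynomial ι ℝ) : ℝ :=
  ∑ γ ∈ f.support, f.coeff γ * y γ

/-- The moment sequence `γ ↦ ∫ θ^γ dφ(θ)` of a measure `φ` on `S`. -/
def momentSeq {ι : Type} {S : Set (ι → ℝ)} (φ : Measure S) (γ : ι →₀ ℕ) : ℝ :=
  ∫ θ : S, γ.prod (fun i e => θ.1 i ^ e) ∂φ

/-- `p α` is, for every multi-index `α`, a polynomial in `θ` of degree at most `|α|` that
represents the `α`-th moment of the mixture `ν_φ`. -/
def RepresentsMoments {ι : Type} {n : ℕ} {S : Set (ι → ℝ)}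
    (κ : Kernel S (EuclideanSpace ℝ (Fin n))) (φ : Measure S)
    (p : (Fin n →₀ ℕ) → MvPolynomial ι ℝ) : Prop :=
  ∀ α, (p α).totalDegree ≤ α.degree ∧
    ∫ x, monom α x ∂(mixture κ φ) = ∫ θ : S, MvPolynomial.eval θ.1 (p α) ∂φ

end MixtureCarleman

end

noncomputable section

namespace MixtureCarleman

/-! ### Moment growth of linear order gives exponential integrability -/

/-! Even coordinate moments depend only on one-dimensional marginals, whose closed forms are bounded
by `(C i * F.growth k) ^ (2 * k)` uniformly over the compact set `S`. Averaging over `φ` preserves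
the bound, and the Riesz functional of `p` is the corresponding moment of the mixture. Since
`F.growth k ≤ k` (`Family.growth_le`), the Carleman series dominates a multiple of the harmonic
series.

Determinacy does not go through Carleman's theorem: linear growth already makes `exp (s * ‖x‖)`
integrable for some `s > 0` (`exists_integrable_exp_norm`). A competitor with the same moments
satisfies the same bounds, hence is also exponentially integrable. For each direction `t` the
complex moment generating functions of `⟨x, t⟩` are then analytic on a strip around the imaginary
axis and have equal Taylor coefficients at `0`. The identity theorem makes them equal at `I`, so the
characteristic functions agree (`eq_of_integral_monom_eq`). -/

theorem exists_integrable_exp_mul_of_moment_le {Ω : Type*} [MeasurableSpace Ω] {μ : Measure Ω}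
    [IsFiniteMeasure μ] {X : Ω → ℝ} (hX : Measurable X) {C : ℝ} (hC : 0 < C)
    (hint : ∀ k : ℕ, 1 ≤ k → Integrable (fun ω => X ω ^ (2 * k)) μ)
    (hle : ∀ k : ℕ, 1 ≤ k → ∫ ω, X ω ^ (2 * k) ∂μ ≤ (C * k) ^ (2 * k)) :
    ∃ s : ℝ, 0 < s ∧ Integrable (fun ω => Real.exp (s * X ω)) μ := by
  -- Since `(2k)^(2k) / (2k)! ≤ e^(2k)`, this `s` bounds the `k`-th term of the integrated cosh
  -- series by `(s * C * e / 2)^(2k) = 4^(-k)`. The term `k = 0` contributes the total mass.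
  set s : ℝ := (Real.exp 1 * C)⁻¹ with hs
  have hs0 : 0 < s := by positivity
  refine ⟨s, hs0, ?_⟩
  have hnn (k : ℕ) (x : ℝ) : 0 ≤ (s * x) ^ (2 * k) / (2 * k).factorial := by
    rw [pow_mul]; positivity
  have hterm (k : ℕ) : ∫⁻ ω, ENNReal.ofReal ((s * X ω) ^ (2 * k) / (2 * k).factorial) ∂μ ≤
      ENNReal.ofReal (μ.real Set.univ * (if k = 0 then 1 else 0) + (1 / 4) ^ k) := by
    rcases Nat.eq_zero_or_pos k with rfl | hk
    · simp only [mul_zero, pow_zero, Nat.factorial_zero, Nat.cast_one, div_one, ENNReal.ofReal_one,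
        lintegral_const, one_mul, if_true, mul_one]
      rw [ENNReal.ofReal_add (by positivity) zero_le_one, ofReal_measureReal]
      exact le_self_add
    · have hi : Integrable (fun ω => (s * X ω) ^ (2 * k) / (2 * k).factorial) μ := by
        simp_rw [mul_pow]
        exact ((hint k hk).const_mul _).div_const _
      rw [← ofReal_integral_eq_lintegral_ofReal hi (.of_forall fun ω => hnn k _)]
      apply ENNReal.ofReal_le_ofReal
      rw [if_neg hk.ne', mul_zero, zero_add]
      simp_rw [mul_pow, mul_div_right_comm]
      rw [integral_const_mul]
      calc s ^ (2 * k) / (2 * k).factorial * ∫ ω, X ω ^ (2 * k) ∂μ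
          ≤ s ^ (2 * k) / (2 * k).factorial * (C * k) ^ (2 * k) := by
            gcongr; exact hle k hk
        _ = (s * C / 2) ^ (2 * k) * (((2 * k : ℕ) : ℝ) ^ (2 * k) / (2 * k).factorial) := by
            rw [div_mul_eq_mul_div, ← mul_div_assoc, ← mul_pow, ← mul_pow]
            congr 2
            push_cast; ring
        _ ≤ (s * C / 2) ^ (2 * k) * Real.exp ((2 * k : ℕ) : ℝ) := by
            refine mul_le_mul_of_nonneg_left ?_ (by rw [pow_mul]; positivity)
            exact Real.pow_div_factorial_le_exp _ (Nat.cast_nonneg _) _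
        _ = (1 / 4) ^ k := by
            rw [← Real.exp_one_pow, ← mul_pow, pow_mul]
            congr 1
            rw [hs]
            have := Real.exp_pos 1
            field_simp
            norm_num
  have hsum : Summable fun k : ℕ =>
      μ.real Set.univ * (if k = 0 then (1 : ℝ) else 0) + (1 / 4) ^ k := by
    apply Summable.add
    · apply Summable.mul_left
      exact (hasSum_ite_eq 0 (1 : ℝ)).summable
    · exact summable_geometric_of_lt_one (by norm_num) (by norm_num)
  -- Only even moments are controlled, hence cosh, which dominates half the exponential.
  have hcosh : ∫⁻ ω, ENNReal.ofReal (Real.cosh (s * X ω)) ∂μ < ∞ := by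
    have h1 (ω : Ω) : ENNReal.ofReal (Real.cosh (s * X ω)) =
        ∑' k : ℕ, ENNReal.ofReal ((s * X ω) ^ (2 * k) / (2 * k).factorial) := by
      rw [← (Real.hasSum_cosh (s * X ω)).tsum_eq,
        ENNReal.ofReal_tsum_of_nonneg (fun k => hnn k _) (Real.hasSum_cosh _).summable]
    simp_rw [h1]
    rw [lintegral_tsum (fun k => by fun_prop)]
    refine (ENNReal.tsum_le_tsum hterm).trans_lt ?_
    rw [← ENNReal.ofReal_tsum_of_nonneg (fun k => by positivity) hsum]
    exact ENNReal.ofReal_lt_top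
  refine ⟨by fun_prop, ?_⟩
  rw [hasFiniteIntegral_iff_ofReal (.of_forall fun _ => (Real.exp_pos _).le)]
  calc ∫⁻ ω, ENNReal.ofReal (Real.exp (s * X ω)) ∂μ
      ≤ ∫⁻ ω, 2 * ENNReal.ofReal (Real.cosh (s * X ω)) ∂μ := by
        apply lintegral_mono
        intro ω
        simp only
        rw [← ENNReal.ofReal_ofNat 2, ← ENNReal.ofReal_mul (by norm_num)]
        apply ENNReal.ofReal_le_ofReal
        rw [Real.cosh_eq]
        have := Real.exp_pos (-(s * X ω))
        linarith
    _ < ∞ := by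
        rw [lintegral_const_mul _ (by fun_prop)]
        exact ENNReal.mul_lt_top (by simp) hcosh

/-- Power mean inequality for the squares `x i ^ 2`; it removes any need for mixed moments. -/
theorem norm_pow_two_mul_le_sum {n : ℕ} (x : EuclideanSpace ℝ (Fin n)) {k : ℕ} (hk : 1 ≤ k) :
    ‖x‖ ^ (2 * k) ≤ (n : ℝ) ^ (k - 1) * ∑ i, x i ^ (2 * k) := by
  obtain ⟨m, rfl⟩ := Nat.exists_eq_add_of_le' hk
  rcases Nat.eq_zero_or_pos n with rfl | hn
  · rw [Subsingleton.elim x 0]; simp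
  have h := pow_sum_div_card_le_sum_pow (s := Finset.univ) (f := fun i => x i ^ 2)
    (fun i _ => sq_nonneg _) m
  rw [div_le_iff₀' (by simp; positivity)] at h
  simpa [pow_mul, EuclideanSpace.real_norm_sq_eq] using h

section Growth

variable {n : ℕ} {μ : Measure (EuclideanSpace ℝ (Fin n))}

theorem exists_integrable_exp_norm [IsFiniteMeasure μ] {C : Fin n → ℝ} (hC : ∀ i, 0 < C i)
    (hint : ∀ i, ∀ k : ℕ, 1 ≤ k → Integrable (fun x => x i ^ (2 * k)) μ)
    (hle : ∀ i, ∀ k : ℕ, 1 ≤ k → ∫ x, x i ^ (2 * k) ∂μ ≤ (C i * k) ^ (2 * k)) :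
    ∃ s : ℝ, 0 < s ∧ Integrable (fun x => Real.exp (s * ‖x‖)) μ := by
  have hD : 0 ≤ ∑ i, C i := Finset.sum_nonneg fun i _ => (hC i).le
  have hsum (k : ℕ) (hk : 1 ≤ k) : Integrable
      (fun x : EuclideanSpace ℝ (Fin n) => (n : ℝ) ^ (k - 1) * ∑ i, x i ^ (2 * k)) μ :=
    (integrable_finsetSum _ fun i _ => hint i k hk).const_mul _
  have hnorm (k : ℕ) (hk : 1 ≤ k) : Integrable (fun x => ‖x‖ ^ (2 * k)) μ := by
    refine (hsum k hk).mono' (by fun_prop) (.of_forall fun x => ?_)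
    rw [Real.norm_of_nonneg (by positivity)]
    exact norm_pow_two_mul_le_sum x hk
  -- The summand `1` keeps the constant positive when `n = 0`.
  refine exists_integrable_exp_mul_of_moment_le (C := n * ∑ i, C i + 1) measurable_norm
    (by positivity) hnorm fun k hk => ?_
  calc ∫ x, ‖x‖ ^ (2 * k) ∂μ
      ≤ ∫ x, (n : ℝ) ^ (k - 1) * ∑ i, x i ^ (2 * k) ∂μ :=
        integral_mono (hnorm k hk) (hsum k hk) fun x => norm_pow_two_mul_le_sum x hk
    _ = (n : ℝ) ^ (k - 1) * ∑ i, ∫ x, x i ^ (2 * k) ∂μ := by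
        rw [integral_const_mul, integral_finsetSum _ fun i _ => hint i k hk]
    _ ≤ (n : ℝ) ^ (k - 1) * ∑ _i : Fin n, ((∑ j, C j) * k) ^ (2 * k) := by
        gcongr with i
        refine (hle i k hk).trans ?_
        have := (hC i).le
        gcongr
        exact Finset.single_le_sum (fun j _ => (hC j).le) (Finset.mem_univ i)
    _ = (n : ℝ) ^ k * ((∑ j, C j) * k) ^ (2 * k) := by
        obtain ⟨m, rfl⟩ := Nat.exists_eq_add_of_le' hk
        simp [pow_succ (n : ℝ) m, mul_assoc]
    _ ≤ (n : ℝ) ^ (2 * k) * ((∑ j, C j) * k) ^ (2 * k) := by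
        refine mul_le_mul_of_nonneg_right ?_ (by rw [pow_mul]; positivity)
        rcases Nat.eq_zero_or_pos n with rfl | hn
        · simp [show k ≠ 0 by omega, zero_pow]
        · exact pow_le_pow_right₀ (by exact_mod_cast hn) (by omega)
    _ ≤ ((n * ∑ i, C i + 1) * k) ^ (2 * k) := by
        rw [← mul_pow, ← mul_assoc]
        gcongr
        linarith

theorem integrable_monom_of_integrable_exp_norm {s : ℝ} (hs : 0 < s)
    (h : Integrable (fun x => Real.exp (s * ‖x‖)) μ) (α : Fin n →₀ ℕ) :
    Integrable (monom α) μ := by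
  set N := ∑ i, α i with hN
  refine (h.const_mul (N.factorial / s ^ N)).mono' ?_ (.of_forall fun x => ?_)
  · unfold monom; fun_prop
  · have h1 := Real.pow_div_factorial_le_exp (s * ‖x‖) (by positivity) N
    rw [div_le_iff₀ (by positivity), mul_pow] at h1
    calc ‖monom α x‖ = ∏ i, ‖x i‖ ^ α i := by simp [monom]
      _ ≤ ∏ i, ‖x‖ ^ α i := by
          gcongr with i
          exact PiLp.norm_apply_le x i
      _ = ‖x‖ ^ N := by rw [Finset.prod_pow_eq_pow_sum]
      _ ≤ _ := by
          rw [div_mul_eq_mul_div, le_div_iff₀ (by positivity)]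
          linarith

theorem zero_mem_interior_integrableExpSet_inner {s : ℝ} (hs : 0 < s)
    (h : Integrable (fun x => Real.exp (s * ‖x‖)) μ) (t : EuclideanSpace ℝ (Fin n)) :
    0 ∈ interior (integrableExpSet (fun x => inner ℝ x t) μ) := by
  rw [mem_interior_iff_mem_nhds, Metric.mem_nhds_iff]
  -- Cauchy–Schwarz needs `|u| * ‖t‖ ≤ s`; the `+ 1` covers `t = 0`.
  refine ⟨s / (‖t‖ + 1), by positivity, fun u hu => ?_⟩
  rw [mem_ball_zero_iff, lt_div_iff₀ (by positivity)] at hu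
  refine h.mono' (by fun_prop) (.of_forall fun x => ?_)
  rw [Real.norm_of_nonneg (Real.exp_pos _).le, Real.exp_le_exp]
  calc u * inner ℝ x t ≤ ‖u‖ * ‖inner ℝ x t‖ := by
        rw [← norm_mul]; exact Real.le_norm_self _
    _ ≤ ‖u‖ * (‖x‖ * ‖t‖) := by gcongr; exact norm_inner_le_norm _ _
    _ = (‖u‖ * ‖t‖) * ‖x‖ := by ring
    _ ≤ s * ‖x‖ := by
        gcongr
        nlinarith [norm_nonneg u]

end Growth

/-! ### Determinacy of measures with exponential moments -/

section Determinate

variable {n : ℕ} {μ ν : Measure (EuclideanSpace ℝ (Fin n))}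

theorem integral_inner_pow_congr (hμ : ∀ α, Integrable (monom α) μ)
    (hν : ∀ α, Integrable (monom α) ν) (h : ∀ α, ∫ x, monom α x ∂μ = ∫ x, monom α x ∂ν)
    (t : EuclideanSpace ℝ (Fin n)) (N : ℕ) :
    ∫ x, (inner ℝ x t) ^ N ∂μ = ∫ x, (inner ℝ x t) ^ N ∂ν := by
  set f : MvPolynomial (Fin n) ℝ := (∑ i, MvPolynomial.C (t i) * MvPolynomial.X i) ^ N with hf
  have hx (x : EuclideanSpace ℝ (Fin n)) :
      inner ℝ x t ^ N = ∑ α ∈ f.support, f.coeff α * monom α x := by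
    have h1 : MvPolynomial.eval (fun i => x i) f = inner ℝ x t ^ N := by
      simp [hf, PiLp.inner_apply]
    rw [← h1, MvPolynomial.eval_eq']
    rfl
  simp_rw [hx]
  rw [integral_finsetSum _ fun α _ => (hμ α).const_mul _,
    integral_finsetSum _ fun α _ => (hν α).const_mul _]
  simp_rw [integral_const_mul, h]

/-- The Taylor coefficients at `0` are the moments up to factorials. -/
theorem complexMGF_eventuallyEq {Ω : Type*} [MeasurableSpace Ω] {μ ν : Measure Ω} {X : Ω → ℝ}
    (hμ : 0 ∈ interior (integrableExpSet X μ)) (hν : 0 ∈ interior (integrableExpSet X ν))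
    (h : ∀ N : ℕ, ∫ ω, X ω ^ N ∂μ = ∫ ω, X ω ^ N ∂ν) :
    complexMGF X μ =ᶠ[nhds 0] complexMGF X ν := by
  have h1 := (analyticAt_complexMGF (z := 0) (by simpa using hμ)).hasFPowerSeriesAt
  have h2 := (analyticAt_complexMGF (z := 0) (by simpa using hν)).hasFPowerSeriesAt
  have h3 (N : ℕ) : iteratedDeriv N (complexMGF X μ) 0 = iteratedDeriv N (complexMGF X ν) 0 := by
    rw [iteratedDeriv_complexMGF (by simpa using hμ), iteratedDeriv_complexMGF (by simpa using hν)]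
    simp only [zero_mul, Complex.exp_zero, mul_one]
    have h4 := h N
    rw [← Complex.ofReal_inj, ← integral_complex_ofReal, ← integral_complex_ofReal] at h4
    simpa using h4
  simp_rw [h3] at h1
  filter_upwards [h1.eventually_hasSum_sub, h2.eventually_hasSum_sub] with z hz hz'
  exact hz.unique hz'

theorem isPreconnected_re_mem_interior_integrableExpSet {Ω : Type*} [MeasurableSpace Ω]
    {μ ν : Measure Ω} {X : Ω → ℝ} :
    IsPreconnected {z : ℂ | z.re ∈ interior (integrableExpSet X μ) ∩
      interior (integrableExpSet X ν)} :=
  ((convex_integrableExpSet.interior.inter convex_integrableExpSet.interior).linear_preimage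
    Complex.reLm).isPreconnected

theorem eq_of_integral_monom_eq [IsFiniteMeasure μ] [IsFiniteMeasure ν] {s s' : ℝ} (hs : 0 < s)
    (hs' : 0 < s') (hμ : Integrable (fun x => Real.exp (s * ‖x‖)) μ)
    (hν : Integrable (fun x => Real.exp (s' * ‖x‖)) ν)
    (h : ∀ α, ∫ x, monom α x ∂μ = ∫ x, monom α x ∂ν) : μ = ν := by
  apply Measure.ext_of_charFun
  ext t
  have h0 := zero_mem_interior_integrableExpSet_inner hs hμ t
  have h0' := zero_mem_interior_integrableExpSet_inner hs' hν t
  have key := AnalyticOnNhd.eqOn_of_preconnected_of_eventuallyEq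
    (analyticOnNhd_complexMGF.mono fun z hz => hz.1)
    (analyticOnNhd_complexMGF.mono fun z hz => hz.2)
    isPreconnected_re_mem_interior_integrableExpSet (z₀ := 0) (by simpa using ⟨h0, h0'⟩)
    (complexMGF_eventuallyEq h0 h0' (integral_inner_pow_congr
      (integrable_monom_of_integrable_exp_norm hs hμ)
      (integrable_monom_of_integrable_exp_norm hs' hν) h t))
  have hI := key (x := Complex.I) (by simpa using ⟨h0, h0'⟩)
  simpa [complexMGF, charFun_apply, mul_comm] using hI

theorem monom_single (i : Fin n) (N : ℕ) (x : EuclideanSpace ℝ (Fin n)) :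
    monom (Finsupp.single i N) x = x i ^ N := by
  rw [monom, Finset.prod_eq_single i] <;> simp +contextual [eq_comm]

theorem momentDeterminate_of_moment_le [IsFiniteMeasure μ] {C : Fin n → ℝ} (hC : ∀ i, 0 < C i)
    (hint : ∀ i, ∀ k : ℕ, 1 ≤ k → Integrable (fun x => x i ^ (2 * k)) μ)
    (hle : ∀ i, ∀ k : ℕ, 1 ≤ k → ∫ x, x i ^ (2 * k) ∂μ ≤ (C i * k) ^ (2 * k)) :
    MomentDeterminate μ := by
  obtain ⟨s, hs, hexp⟩ := exists_integrable_exp_norm hC hint hle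
  refine ⟨integrable_monom_of_integrable_exp_norm hs hexp, fun ν hν h => ?_⟩
  have hfin : IsFiniteMeasure ν := by
    have h1 := hν 0
    have h2 : monom (n := n) 0 = fun _ => (1 : ℝ) := by ext x; simp [monom]
    rw [h2, integrable_const_iff] at h1
    simpa using h1
  -- The growth bound passes to the competitor because it involves moments only.
  obtain ⟨s', hs', hexp'⟩ := exists_integrable_exp_norm (μ := ν) hC
    (fun i k _ => by
      have := hν (Finsupp.single i (2 * k))
      rwa [funext (monom_single i (2 * k))] at this)
    (fun i k hk => by
      have := h (Finsupp.single i (2 * k))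
      simp only [monom_single] at this
      exact this.trans_le (hle i k hk))
  exact eq_of_integral_monom_eq hs' hs hexp' hexp h

end Determinate

/-! ### Moments of the Poisson law -/

theorem self_mul_descFactorial (n j : ℕ) :
    n * n.descFactorial j = n.descFactorial (j + 1) + j * n.descFactorial j := by
  rw [Nat.descFactorial_succ, ← add_mul]
  rcases le_or_gt j n with h | h
  · rw [Nat.sub_add_cancel h]
  · simp [Nat.descFactorial_eq_zero_iff_lt.2 h]

theorem pow_eq_sum_stirlingSecond_mul_descFactorial (n N : ℕ) :
    n ^ N = ∑ j ∈ Finset.range (N + 1), N.stirlingSecond j * n.descFactorial j := by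
  induction N with
  | zero => simp
  | succ N ih =>
    -- Index shift: the added top term has Stirling number zero, and the dropped bottom term has the
    -- factor `j = 0`.
    have h1 : ∑ j ∈ Finset.range (N + 1), N.stirlingSecond j * (j * n.descFactorial j) =
        ∑ j ∈ Finset.range (N + 1),
          N.stirlingSecond (j + 1) * ((j + 1) * n.descFactorial (j + 1)) := by
      have h2 := Finset.sum_range_succ
        (fun j => N.stirlingSecond j * (j * n.descFactorial j)) (N + 1)
      rw [Nat.stirlingSecond_eq_zero_of_lt (Nat.lt_succ_self N), zero_mul, add_zero] at h2
      rw [← h2, Finset.sum_range_succ']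
      simp
    rw [pow_succ', ih, Finset.mul_sum, Finset.sum_range_succ' _ (N + 1)]
    simp only [Nat.stirlingSecond_succ_zero, zero_mul, add_zero, Nat.stirlingSecond_succ_succ]
    calc ∑ j ∈ Finset.range (N + 1), n * (N.stirlingSecond j * n.descFactorial j)
        = ∑ j ∈ Finset.range (N + 1), (N.stirlingSecond j * n.descFactorial (j + 1) +
            N.stirlingSecond j * (j * n.descFactorial j)) := by
          refine Finset.sum_congr rfl fun j _ => ?_
          rw [mul_left_comm, self_mul_descFactorial, mul_add]
      _ = _ := by
          rw [Finset.sum_add_distrib, h1, ← Finset.sum_add_distrib]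
          refine Finset.sum_congr rfl fun j _ => ?_
          ring

/-- The first `j` terms vanish; shifting the rest by `j` leaves `r ^ j` times the total Poisson
mass. -/
theorem hasSum_poisson_descFactorial (r : NNReal) (j : ℕ) :
    HasSum (fun n : ℕ => Real.exp (-r) * r ^ n / n.factorial * (n.descFactorial j : ℝ))
      ((r : ℝ) ^ j) := by
  rw [← hasSum_nat_add_iff' j, Finset.sum_eq_zero, sub_zero]
  · convert! (hasSum_one_poissonMeasure r).mul_left ((r : ℝ) ^ j) using 1
    · ext n
      have h := Nat.factorial_mul_descFactorial (Nat.le_add_left j n)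
      rw [Nat.add_sub_cancel] at h
      rw [← h, pow_add]
      have h1 : (n.factorial : ℝ) ≠ 0 := by positivity
      have h2 : ((n + j).descFactorial j : ℝ) ≠ 0 := by
        exact_mod_cast (Nat.descFactorial_pos.2 (Nat.le_add_left j n)).ne'
      push_cast
      field_simp
    · simp
  · intro n hn
    simp [Nat.descFactorial_eq_zero_iff_lt.2 (Finset.mem_range.1 hn)]

theorem hasSum_poisson_pow (r : NNReal) (N : ℕ) :
    HasSum (fun n : ℕ => Real.exp (-r) * r ^ n / n.factorial * (n : ℝ) ^ N)
      (∑ j ∈ Finset.range (N + 1), (N.stirlingSecond j : ℝ) * (r : ℝ) ^ j) := by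
  convert! hasSum_sum (s := Finset.range (N + 1)) fun j _ =>
    (hasSum_poisson_descFactorial r j).mul_left (N.stirlingSecond j : ℝ) using 1
  ext n
  rw [← Nat.cast_pow, pow_eq_sum_stirlingSecond_mul_descFactorial, Nat.cast_sum, Finset.mul_sum]
  refine Finset.sum_congr rfl fun j _ => ?_
  push_cast
  ring

theorem integrable_pow_poissonMeasure (r : NNReal) (N : ℕ) :
    Integrable (fun n : ℕ => (n : ℝ) ^ N) (poissonMeasure r) := by
  rw [integrable_poissonMeasure_iff]
  simpa using (hasSum_poisson_pow r N).summable

theorem integral_pow_poissonMeasure (r : NNReal) (N : ℕ) :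
    ∫ n, (n : ℝ) ^ N ∂(poissonMeasure r) =
      ∑ j ∈ Finset.range (N + 1), (N.stirlingSecond j : ℝ) * (r : ℝ) ^ j := by
  rw [integral_poissonMeasure]
  exact (hasSum_poisson_pow r N).tsum_eq

theorem hasSum_poisson_exp (r : NNReal) (s : ℝ) :
    HasSum (fun n : ℕ => Real.exp (-r) * r ^ n / n.factorial * Real.exp (s * n))
      (Real.exp (r * (Real.exp s - 1))) := by
  convert! (NormedSpace.expSeries_div_hasSum_exp ((r : ℝ) * Real.exp s)).mul_left
    (Real.exp (-r)) using 1
  · ext n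
    rw [mul_pow, ← Real.exp_nat_mul, mul_comm s]
    ring
  · rw [← Real.exp_eq_exp_ℝ, ← Real.exp_add]
    ring_nf

/-- Chernoff-type bound: `n^N ≤ (N/s)^N * exp (s * n)` is summed against the Poisson weights, with
`s` left free for optimisation. -/
theorem poisson_moment_le (r : NNReal) {N : ℕ} {s : ℝ} (hs : 0 < s) :
    ∑ j ∈ Finset.range (N + 1), (N.stirlingSecond j : ℝ) * (r : ℝ) ^ j ≤
      (N / s) ^ N * Real.exp (r * (Real.exp s - 1)) := by
  refine hasSum_le (fun n => ?_) (hasSum_poisson_pow r N)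
    ((hasSum_poisson_exp r s).mul_left ((N / s) ^ N))
  rw [mul_left_comm]
  gcongr
  have h := Real.pow_div_factorial_le_exp (s * n) (by positivity) N
  rw [div_le_iff₀ (by positivity), mul_pow] at h
  rw [div_pow, div_mul_eq_mul_div, le_div_iff₀ (by positivity)]
  calc (n : ℝ) ^ N * s ^ N ≤ Real.exp (s * n) * N.factorial := by linarith
    _ ≤ Real.exp (s * n) * N ^ N := by
        gcongr
        exact_mod_cast N.factorial_le_pow
    _ = _ := mul_comm _ _

theorem touchard_two_mul_le {r : NNReal} {R : ℝ} (hr : (r : ℝ) ≤ R) {k : ℕ} (hk : 1 ≤ k) :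
    ∑ j ∈ Finset.range (2 * k + 1), ((2 * k).stirlingSecond j : ℝ) * (r : ℝ) ^ j ≤
      (2 * Real.exp R * (k / Real.log (2 * k + 1))) ^ (2 * k) := by
  have hk' : (1 : ℝ) ≤ k := by exact_mod_cast hk
  have hlog : 0 < Real.log (2 * k + 1) := Real.log_pos (by linarith)
  -- With `s = log (2k + 1)` the exponent `r * (exp s - 1)` is `2k * r`, which a `2k`-th power
  -- absorbs.
  refine (poisson_moment_le r hlog).trans ?_
  rw [Real.exp_log (by positivity)]
  calc _ ≤ (((2 * k : ℕ) : ℝ) / Real.log (2 * k + 1)) ^ (2 * k) * Real.exp R ^ (2 * k) := by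
        rw [← Real.exp_nat_mul, add_sub_cancel_right, mul_comm (r : ℝ)]
        push_cast
        gcongr
    _ = _ := by
        rw [← mul_pow]
        push_cast
        ring

/-! ### Moments of the exponential law -/

theorem integral_pow_expMeasure {r : ℝ} (hr : 0 < r) (N : ℕ) :
    ∫ x, x ^ N ∂(expMeasure r) = N.factorial * r⁻¹ ^ N := by
  rw [expMeasure, gammaMeasure, integral_withDensity_eq_integral_toReal_smul₀]
  rotate_left
  · exact (measurable_gammaPDFReal 1 r).ennreal_ofReal.aemeasurable
  · exact .of_forall fun x => ENNReal.ofReal_lt_top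
  rw [← setIntegral_eq_integral_of_forall_compl_eq_zero (s := Set.Ici 0),
    integral_Ici_eq_integral_Ioi]
  · have h := Real.integral_rpow_mul_exp_neg_mul_Ioi (a := (N : ℝ) + 1) (by positivity) hr
    rw [Real.Gamma_nat_eq_factorial] at h
    calc _ = ∫ t in Set.Ioi (0 : ℝ), r * (t ^ ((N : ℝ) + 1 - 1) * Real.exp (-(r * t))) := by
          refine setIntegral_congr_fun measurableSet_Ioi fun x hx => ?_
          have hx' : 0 ≤ x := (Set.mem_Ioi.1 hx).le
          simp only [gammaPDF_of_nonneg hx']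
          rw [ENNReal.toReal_ofReal (by simp; positivity)]
          simp
          ring
      _ = _ := by
          rw [integral_const_mul, h, ← Nat.cast_succ, Real.rpow_natCast, one_div, pow_succ]
          field_simp
  · intro x hx
    rw [gammaPDF_of_neg (by simpa using hx)]
    simp

theorem integrable_pow_expMeasure {r : ℝ} (hr : 0 < r) (N : ℕ) :
    Integrable (fun x => x ^ N) (expMeasure r) := by
  -- The Bochner integral of a non-integrable function is zero, so the nonzero value just computed
  -- suffices.
  apply Integrable.of_integral_ne_zero
  rw [integral_pow_expMeasure hr]
  positivity

theorem factorial_two_mul_mul_pow_le {η R : ℝ} (hη : 0 ≤ η) (hR : η ≤ R) (k : ℕ) :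
    ((2 * k).factorial : ℝ) * η ^ (2 * k) ≤ (2 * R * k) ^ (2 * k) := by
  calc ((2 * k).factorial : ℝ) * η ^ (2 * k) ≤ ((2 * k : ℕ) : ℝ) ^ (2 * k) * R ^ (2 * k) := by
        gcongr
        exact_mod_cast (2 * k).factorial_le_pow
    _ = _ := by
        rw [← mul_pow]
        push_cast
        ring

/-! ### Moments of the Gaussian law -/

theorem integral_pow_odd_gaussianReal (l : ℕ) :
    ∫ x, x ^ (2 * l + 1) ∂(gaussianReal 0 1) = 0 := by
  have h : ∫ x, x ^ (2 * l + 1) ∂((gaussianReal 0 1).map (fun x => -x)) =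
      ∫ x, (-x) ^ (2 * l + 1) ∂(gaussianReal 0 1) := integral_map (by fun_prop) (by fun_prop)
  rw [gaussianReal_map_neg, neg_zero] at h
  simp_rw [Odd.neg_pow ⟨l, rfl⟩, integral_neg] at h
  linarith

theorem integral_pow_even_gaussianReal (l : ℕ) :
    ∫ x, x ^ (2 * l) ∂(gaussianReal 0 1) = (Nat.doubleFactorial (2 * l - 1) : ℝ) := by
  rw [integral_gaussianReal_eq_integral_smul one_ne_zero]
  have h := integral_rpow_mul_exp_neg_mul_rpow (p := 2) (q := ((2 * l : ℕ) : ℝ)) (b := 1 / 2)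
    (by norm_num) (by have : (0 : ℝ) ≤ ((2 * l : ℕ) : ℝ) := by positivity
                      linarith) (by norm_num)
  rw [show (((2 * l : ℕ) : ℝ) + 1) / 2 = l + 1 / 2 by push_cast; ring,
    show -(((2 * l : ℕ) : ℝ) + 1) / 2 = -(l + 1 / 2) by push_cast; ring,
    Real.Gamma_nat_add_half] at h
  -- Evenness reduces the integral to the half-line, where it is a Gamma value at a half-integer.
  have habs := integral_comp_abs (f := fun x : ℝ =>
    x ^ ((2 * l : ℕ) : ℝ) * Real.exp (-(1 / 2) * x ^ (2 : ℝ)))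
  rw [h] at habs
  calc _ = ∫ x : ℝ, (√(2 * Real.pi))⁻¹ *
        (|x| ^ ((2 * l : ℕ) : ℝ) * Real.exp (-(1 / 2) * |x| ^ (2 : ℝ))) := by
        congr 1
        ext x
        rw [Real.rpow_natCast, Real.rpow_two, sq_abs, Even.pow_abs (even_two_mul l)]
        simp only [gaussianPDFReal, NNReal.coe_one, mul_one, sub_zero, smul_eq_mul]
        rw [show -x ^ 2 / 2 = -(1 / 2) * x ^ 2 by ring]
        ring
    _ = _ := by
        rw [integral_const_mul, habs, one_div, Real.inv_rpow zero_le_two, Real.rpow_neg zero_le_two,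
          inv_inv, Real.rpow_add zero_lt_two, Real.rpow_natCast, ← one_div 2,
          ← Real.sqrt_eq_rpow, Real.sqrt_mul zero_le_two]
        have h1 : √(2 : ℝ) ≠ 0 := by positivity
        have h2 : √Real.pi ≠ 0 := by positivity
        field_simp

theorem sum_range_two_mul_add_one_of_odd_eq_zero {f : ℕ → ℝ} (h : ∀ l, f (2 * l + 1) = 0) (k : ℕ) :
    ∑ j ∈ Finset.range (2 * k + 1), f j = ∑ l ∈ Finset.range (k + 1), f (2 * l) := by
  induction k with
  | zero => simp
  | succ k ih =>
    rw [show 2 * (k + 1) + 1 = 2 * k + 1 + 1 + 1 by ring, Finset.sum_range_succ,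
      Finset.sum_range_succ, ih, h, Finset.sum_range_succ _ (k + 1)]
    simp [mul_add]

theorem sum_range_even_le {f : ℕ → ℝ} (h : ∀ j, 0 ≤ f j) (k : ℕ) :
    ∑ l ∈ Finset.range (k + 1), f (2 * l) ≤ ∑ j ∈ Finset.range (2 * k + 1), f j := by
  induction k with
  | zero => simp
  | succ k ih =>
    rw [show 2 * (k + 1) + 1 = 2 * k + 1 + 1 + 1 by ring, Finset.sum_range_succ _ (k + 1),
      Finset.sum_range_succ _ (2 * k + 1 + 1), Finset.sum_range_succ _ (2 * k + 1)]
    have := h (2 * k + 1)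
    simp only [mul_add, mul_one]
    linarith

theorem gaussianReal_eq_map_standard (m : ℝ) (v : NNReal) :
    gaussianReal m v = (gaussianReal 0 1).map fun z => √(v : ℝ) * z + m := by
  have h : (fun z => √(v : ℝ) * z + m) = (fun z => z + m) ∘ (fun z => √(v : ℝ) * z) := rfl
  rw [h, ← Measure.map_map (by fun_prop) (by fun_prop), gaussianReal_map_const_mul,
    gaussianReal_map_add_const]
  congr 1
  · simp
  · ext
    simp

theorem integrable_pow_gaussianReal (m : ℝ) (v : NNReal) (N : ℕ) :
    Integrable (fun x => x ^ N) (gaussianReal m v) := by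
  have h := (memLp_id_gaussianReal' (μ := m) (v := v) N (by simp)).integrable_norm_pow'
  exact h.mono (by fun_prop) (.of_forall fun x => by simp)

theorem integral_pow_gaussianReal (m : ℝ) (v : NNReal) (k : ℕ) :
    ∫ x, x ^ (2 * k) ∂(gaussianReal m v) = ∑ l ∈ Finset.range (k + 1),
      ((2 * k).choose (2 * l) : ℝ) * m ^ (2 * k - 2 * l) * (v : ℝ) ^ l *
        (Nat.doubleFactorial (2 * l - 1) : ℝ) := by
  rw [gaussianReal_eq_map_standard, integral_map (by fun_prop) (by fun_prop)]
  have hx (z : ℝ) : (√(v : ℝ) * z + m) ^ (2 * k) = ∑ j ∈ Finset.range (2 * k + 1),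
      (((2 * k).choose j : ℝ) * m ^ (2 * k - j) * √(v : ℝ) ^ j) * z ^ j := by
    rw [add_pow]
    refine Finset.sum_congr rfl fun j _ => ?_
    ring
  simp_rw [hx]
  rw [integral_finsetSum _ fun j _ => (integrable_pow_gaussianReal 0 1 j).const_mul _]
  simp_rw [integral_const_mul]
  rw [sum_range_two_mul_add_one_of_odd_eq_zero fun l => by
    rw [integral_pow_odd_gaussianReal, mul_zero]]
  refine Finset.sum_congr rfl fun l _ => ?_
  rw [integral_pow_even_gaussianReal, pow_mul, Real.sq_sqrt v.coe_nonneg]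

theorem doubleFactorial_two_mul_sub_one_le {k l : ℕ} (h : l ≤ k) :
    Nat.doubleFactorial (2 * l - 1) ≤ (2 * k) ^ l := by
  induction l with
  | zero => simp
  | succ l ih =>
    rw [show 2 * (l + 1) - 1 = 2 * l + 1 by omega, Nat.doubleFactorial_add_one, pow_succ']
    exact Nat.mul_le_mul (by omega) (ih (by omega))

/-- Each term is at most the even-index term of the binomial expansion of the right side, since `(2l
- 1)!! ≤ (2k)^l`. As `1 ≤ √k`, `M` may be enlarged to `M * √k`. -/
theorem gaussian_moment_le {m v M V : ℝ} (hv : 0 ≤ v) (hm : |m| ≤ M) (hV : v ≤ V) {k : ℕ}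
    (hk : 1 ≤ k) :
    ∑ l ∈ Finset.range (k + 1), ((2 * k).choose (2 * l) : ℝ) * m ^ (2 * k - 2 * l) * v ^ l *
        (Nat.doubleFactorial (2 * l - 1) : ℝ) ≤ ((M + √(2 * V)) * √(k : ℝ)) ^ (2 * k) := by
  have hM : 0 ≤ M := (abs_nonneg m).trans hm
  have hV0 : 0 ≤ V := hv.trans hV
  have hk1 : 1 ≤ √(k : ℝ) := by rw [Real.one_le_sqrt]; exact_mod_cast hk
  rw [show (M + √(2 * V)) * √(k : ℝ) = √(2 * V) * √(k : ℝ) + M * √(k : ℝ) by ring, add_pow]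
  refine le_trans (Finset.sum_le_sum fun l hl => ?_) (sum_range_even_le (fun j => by positivity) k)
  have hlk : l ≤ k := Nat.lt_succ_iff.1 (Finset.mem_range.1 hl)
  have h1 : m ^ (2 * k - 2 * l) ≤ (M * √(k : ℝ)) ^ (2 * k - 2 * l) := by
    rw [← Nat.mul_sub, ← Even.pow_abs (even_two_mul (k - l))]
    gcongr
    nlinarith
  have h2 : v ^ l * (Nat.doubleFactorial (2 * l - 1) : ℝ) ≤ (√(2 * V) * √(k : ℝ)) ^ (2 * l) := by
    rw [pow_mul, mul_pow, Real.sq_sqrt (by positivity), Real.sq_sqrt (by positivity)]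
    calc v ^ l * (Nat.doubleFactorial (2 * l - 1) : ℝ) ≤ V ^ l * ((2 * k : ℕ) : ℝ) ^ l := by
          gcongr
          exact_mod_cast doubleFactorial_two_mul_sub_one_le hlk
      _ = _ := by
          rw [← mul_pow]
          push_cast
          ring
  calc _ = ((2 * k).choose (2 * l) : ℝ) * (m ^ (2 * k - 2 * l) *
          (v ^ l * (Nat.doubleFactorial (2 * l - 1) : ℝ))) := by ring
    _ ≤ ((2 * k).choose (2 * l) : ℝ) * ((M * √(k : ℝ)) ^ (2 * k - 2 * l) *
          (√(2 * V) * √(k : ℝ)) ^ (2 * l)) := by gcongr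
    _ = _ := by ring

/-! ### Uniform moment bounds on a compact parameter set -/

theorem _root_.IsCompact.exists_abs_apply_le {ι : Type*} {S : Set (ι → ℝ)} (hS : IsCompact S) :
    ∃ M : ι → ℝ, (∀ j, 0 ≤ M j) ∧ ∀ j, ∀ θ ∈ S, |θ j| ≤ M j := by
  have h (j : ι) : ∃ M : ℝ, 0 ≤ M ∧ ∀ θ ∈ S, |θ j| ≤ M := by
    obtain ⟨M, hM⟩ := (hS.image (f := fun θ => |θ j|) (by fun_prop)).bddAbove
    exact ⟨max M 0, le_max_right _ _, fun θ hθ =>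
      (hM (Set.mem_image_of_mem _ hθ)).trans (le_max_left _ _)⟩
  choose M hM using h
  exact ⟨M, fun j => (hM j).1, fun j => (hM j).2⟩

theorem Family.growth_pos (F : Family) {k : ℕ} (hk : 1 ≤ k) : 0 < F.growth k := by
  have hk' : (1 : ℝ) ≤ k := by exact_mod_cast hk
  cases F with
  | gaussian => exact Real.sqrt_pos.2 (by linarith)
  | poisson => exact div_pos (by linarith) (Real.log_pos (by linarith))
  | exponential => exact zero_lt_one.trans_le hk'

theorem Family.growth_le (F : Family) {k : ℕ} (hk : 1 ≤ k) : F.growth k ≤ k := by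
  have hk' : (1 : ℝ) ≤ k := by exact_mod_cast hk
  cases F with
  | gaussian =>
    refine Real.sqrt_le_iff.2 ⟨by linarith, ?_⟩
    nlinarith
  | poisson =>
    refine div_le_self (by linarith) ?_
    -- For `k ≥ 1` one has `2k + 1 ≥ 3 > e`.
    rw [Real.le_log_iff_exp_le (by linarith)]
    linarith [Real.exp_one_lt_three]
  | exponential => exact le_rfl

section Component

variable {n : ℕ} {μ : Measure (EuclideanSpace ℝ (Fin n))}

theorem integrable_pow_apply_of_map {ρ : Measure ℝ} {i : Fin n} (h : μ.map (fun x => x i) = ρ)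
    {N : ℕ} (hρ : Integrable (fun y => y ^ N) ρ) : Integrable (fun x => x i ^ N) μ := by
  subst h
  exact (integrable_map_measure (measurable_id.pow_const N).aestronglyMeasurable (by fun_prop)).1 hρ

theorem integral_pow_apply_of_map {ρ : Measure ℝ} {i : Fin n} (h : μ.map (fun x => x i) = ρ)
    (N : ℕ) : ∫ x, x i ^ N ∂μ = ∫ y, y ^ N ∂ρ := by
  rw [← h, integral_map (by fun_prop) (by fun_prop)]

theorem Family.IsComponent.integrable_and_integral_eq {F : Family} {θ : F.Index n → ℝ}
    (h : F.IsComponent θ μ) (i : Fin n) (k : ℕ) :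
    Integrable (fun x => x i ^ (2 * k)) μ ∧ ∫ x, x i ^ (2 * k) ∂μ = F.evenMoment θ i k := by
  cases F with
  | gaussian =>
    obtain ⟨hpos, rfl⟩ := h
    have hmap := (measurePreserving_eval_multivariateGaussian (μ := gaussMean θ) hpos
      (i := i)).map_eq
    refine ⟨integrable_pow_apply_of_map hmap (integrable_pow_gaussianReal _ _ _), ?_⟩
    rw [integral_pow_apply_of_map hmap, integral_pow_gaussianReal,
      Real.coe_toNNReal _ hpos.diag_nonneg]
    rfl
  | poisson =>
    obtain ⟨hpos, hmap⟩ := h i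
    have hint : Integrable (fun y : ℝ => y ^ (2 * k))
        ((poissonMeasure (θ i).toNNReal).map (fun m : ℕ => (m : ℝ))) :=
      (integrable_map_measure (measurable_id.pow_const _).aestronglyMeasurable .of_discrete).2
        (integrable_pow_poissonMeasure _ _)
    refine ⟨integrable_pow_apply_of_map hmap hint, ?_⟩
    rw [integral_pow_apply_of_map hmap, integral_map .of_discrete (by fun_prop),
      integral_pow_poissonMeasure, Real.coe_toNNReal _ hpos.le]
    rfl
  | exponential =>
    obtain ⟨hpos, hmap⟩ := h i
    refine ⟨integrable_pow_apply_of_map hmap (integrable_pow_expMeasure (inv_pos.2 hpos) _), ?_⟩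
    rw [integral_pow_apply_of_map hmap, integral_pow_expMeasure (inv_pos.2 hpos), inv_inv]
    rfl

end Component

/-- Compactness bounds each parameter coordinate. The component law only supplies the sign
conditions on `θ`. -/
theorem Family.exists_evenMoment_le {n : ℕ} (F : Family) {S : Set (F.Index n → ℝ)}
    (hS : IsCompact S) : ∃ C : Fin n → ℝ, (∀ i, 0 < C i) ∧
      ∀ (i : Fin n) (k : ℕ), 1 ≤ k → ∀ θ ∈ S, ∀ μ, F.IsComponent θ μ →
        F.evenMoment θ i k ≤ (C i * F.growth k) ^ (2 * k) := by
  obtain ⟨M, hM0, hM⟩ := hS.exists_abs_apply_le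
  cases F with
  | gaussian =>
    refine ⟨fun i => M (.inl i) + √(2 * M (.inr ⟨(min i i, max i i), min_le_max⟩)) + 1,
      fun i => ?_, fun i k hk θ hθ μ hμ => ?_⟩
    · have := hM0 (.inl i)
      positivity
    · refine (gaussian_moment_le hμ.1.diag_nonneg (hM (.inl i) θ hθ)
        ((le_abs_self _).trans (hM (.inr ⟨(min i i, max i i), min_le_max⟩) θ hθ)) hk).trans ?_
      have := hM0 (.inl i)
      unfold Family.growth
      gcongr
      linarith
  | poisson =>
    refine ⟨fun i => 2 * Real.exp (M i), fun i => by positivity, fun i k hk θ hθ μ hμ => ?_⟩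
    have hpos := (hμ i).1
    have h := touchard_two_mul_le (r := (θ i).toNNReal) (R := M i)
      (by rw [Real.coe_toNNReal _ hpos.le]; exact (le_abs_self _).trans (hM i θ hθ)) hk
    rwa [Real.coe_toNNReal _ hpos.le] at h
  | exponential =>
    refine ⟨fun i => 2 * M i + 1, fun i => ?_, fun i k hk θ hθ μ hμ => ?_⟩
    · have := hM0 i
      positivity
    · refine (factorial_two_mul_mul_pow_le (hμ i).1.le ((le_abs_self _).trans (hM i θ hθ))
        k).trans ?_
      have := hM0 i
      unfold Family.growth
      gcongr
      linarith

/-! ### The mixture and its Riesz functional -/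

section Mixture

variable {ι : Type} {n : ℕ} {S : Set (ι → ℝ)} {κ : Kernel S (EuclideanSpace ℝ (Fin n))}
  {φ : Measure S} [IsProbabilityMeasure φ]

instance [IsMarkovKernel κ] : IsProbabilityMeasure (mixture κ φ) :=
  inferInstanceAs (IsProbabilityMeasure (φ.bind κ))

theorem integrable_mixture_and_integral_le {f : EuclideanSpace ℝ (Fin n) → ℝ} (hf : Measurable f)
    (hf0 : 0 ≤ f) {B : ℝ} (hB : 0 ≤ B) (hint : ∀ θ, Integrable f (κ θ))
    (hle : ∀ θ, ∫ x, f x ∂(κ θ) ≤ B) :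
    Integrable f (mixture κ φ) ∧ ∫ x, f x ∂(mixture κ φ) ≤ B := by
  have h : ∫⁻ x, ENNReal.ofReal (f x) ∂(mixture κ φ) ≤ ENNReal.ofReal B := by
    rw [mixture, Measure.lintegral_bind κ.measurable.aemeasurable (by fun_prop)]
    calc ∫⁻ θ, ∫⁻ x, ENNReal.ofReal (f x) ∂(κ θ) ∂φ ≤ ∫⁻ _θ, ENNReal.ofReal B ∂φ := by
          refine lintegral_mono fun θ => ?_
          rw [← ofReal_integral_eq_lintegral_ofReal (hint θ) (.of_forall hf0)]
          exact ENNReal.ofReal_le_ofReal (hle θ)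
      _ = ENNReal.ofReal B := by simp
  refine ⟨⟨by fun_prop, ?_⟩, ?_⟩
  · rw [hasFiniteIntegral_iff_ofReal (.of_forall hf0)]
    exact h.trans_lt ENNReal.ofReal_lt_top
  · rw [integral_eq_lintegral_of_nonneg_ae (.of_forall hf0) (by fun_prop)]
    exact ENNReal.toReal_le_of_le_ofReal hB h

/-- Monomials are bounded on the compact `S`, so sum and integral commute. -/
theorem riesz_momentSeq (hS : IsCompact S) (f : MvPolynomial ι ℝ) :
    riesz (momentSeq φ) f = ∫ θ : S, MvPolynomial.eval θ.1 f ∂φ := by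
  have hint (γ : ι →₀ ℕ) : Integrable (fun θ : S => ∏ i ∈ γ.support, θ.1 i ^ γ i) φ := by
    have hcont : Continuous fun θ : ι → ℝ => ∏ i ∈ γ.support, θ i ^ γ i := by fun_prop
    obtain ⟨B, hB⟩ := hS.exists_bound_of_continuousOn hcont.continuousOn
    refine Integrable.of_bound (C := B) ?_ (.of_forall fun θ => hB θ.1 θ.2)
    have hmeas : Measurable fun θ : S => ∏ i ∈ γ.support, θ.1 i ^ γ i :=
      Finset.measurable_fun_prod _ fun i _ =>
        ((measurable_pi_apply i).comp measurable_subtype_coe).pow_const _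
    exact hmeas.aestronglyMeasurable
  simp_rw [MvPolynomial.eval_eq]
  rw [integral_finsetSum _ fun γ _ => (hint γ).const_mul _]
  simp_rw [integral_const_mul]
  rfl

theorem RepresentsMoments.riesz_eq (hS : IsCompact S) {p : (Fin n →₀ ℕ) → MvPolynomial ι ℝ}
    (hp : RepresentsMoments κ φ p) (i : Fin n) (N : ℕ) :
    riesz (momentSeq φ) (p (Finsupp.single i N)) = ∫ x, x i ^ N ∂(mixture κ φ) := by
  rw [riesz_momentSeq hS, ← (hp _).2]
  simp_rw [monom_single]

end Mixture

/-! ### Divergence of the Carleman series -/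

theorem tsum_ofReal_rpow_neg_eq_top {L : ℕ → ℝ} {C : ℝ} (hC : 0 < C)
    (hL : ∀ k : ℕ, L k ≤ (C * (k + 1)) ^ (2 * (k + 1))) :
    ∑' k : ℕ, ENNReal.ofReal (L k) ^ (-(1 / (2 * ((k : ℝ) + 1)))) = ∞ := by
  -- The index `k` stands for order `2(k + 1)`. In `ℝ≥0∞` a negative power of `0` is `∞`, so
  -- vanishing moments need no separate case.
  have hterm (k : ℕ) : ENNReal.ofReal (C⁻¹ * (1 / ((k : ℝ) + 1))) ≤
      ENNReal.ofReal (L k) ^ (-(1 / (2 * ((k : ℝ) + 1)))) := by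
    have hpos : 0 < C * ((k : ℝ) + 1) := by positivity
    rw [ENNReal.rpow_neg, one_div, ← mul_inv, ENNReal.ofReal_inv_of_pos hpos]
    refine ENNReal.inv_le_inv.2 ?_
    calc ENNReal.ofReal (L k) ^ (1 / (2 * ((k : ℝ) + 1)))
        ≤ ENNReal.ofReal ((C * (k + 1)) ^ (2 * (k + 1))) ^ (1 / (2 * ((k : ℝ) + 1))) :=
          ENNReal.rpow_le_rpow (ENNReal.ofReal_le_ofReal (hL k)) (by positivity)
      _ = ENNReal.ofReal (C * (k + 1)) := by
          rw [ENNReal.ofReal_rpow_of_pos (by positivity), ← Real.rpow_natCast,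
            ← Real.rpow_mul hpos.le]
          push_cast
          rw [mul_one_div_cancel (by positivity), Real.rpow_one]
  rw [eq_top_iff]
  refine le_trans (le_of_eq ?_) (ENNReal.tsum_le_tsum hterm)
  by_contra hne
  have hs := ENNReal.summable_toReal (Ne.symm hne)
  have hs' : Summable fun k : ℕ => C⁻¹ * (1 / ((k : ℝ) + 1)) := by
    refine hs.congr fun k => ?_
    rw [ENNReal.toReal_ofReal (by positivity)]
  rw [summable_mul_left_iff (inv_ne_zero hC.ne')] at hs'
  refine Real.not_summable_one_div_natCast ((summable_nat_add_iff 1).1 ?_)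
  simpa using hs'

end MixtureCarleman

end

theorem mainTheorem5 (F : MixtureCarleman.Family) (n : ℕ) (S : Set (F.Index n → ℝ))
    (hS : IsCompact S) (κ : Kernel S (EuclideanSpace ℝ (Fin n))) [IsMarkovKernel κ]
    (hκ : ∀ θ : S, F.IsComponent θ.1 (κ θ)) :
    ∃ C : Fin n → ℝ, (∀ i, 0 < C i) ∧
      (∀ (i : Fin n) (k : ℕ), 1 ≤ k → ∀ θ : S,
        Integrable (fun x => x i ^ (2 * k)) (κ θ) ∧
        ∫ x, x i ^ (2 * k) ∂(κ θ) = F.evenMoment θ.1 i k ∧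
        F.evenMoment θ.1 i k ≤ (C i * F.growth k) ^ (2 * k)) ∧
      ∀ φ : Measure S, IsProbabilityMeasure φ →
        (∀ p : (Fin n →₀ ℕ) → MvPolynomial (F.Index n) ℝ,
          MixtureCarleman.RepresentsMoments κ φ p → ∀ i : Fin n,
            (∀ k : ℕ, 1 ≤ k →
              MixtureCarleman.riesz (MixtureCarleman.momentSeq φ)
                (p (Finsupp.single i (2 * k))) ≤ (C i * F.growth k) ^ (2 * k)) ∧
            ∑' k : ℕ, ENNReal.ofReal (MixtureCarleman.riesz (MixtureCarleman.momentSeq φ)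
                (p (Finsupp.single i (2 * (k + 1))))) ^ (-(1 / (2 * ((k : ℝ) + 1)))) = ∞) ∧
        MixtureCarleman.MomentDeterminate (MixtureCarleman.mixture κ φ) := by
  obtain ⟨C, hC, hbound⟩ := F.exists_evenMoment_le hS
  have hmom (i : Fin n) (k : ℕ) (θ : S) := (hκ θ).integrable_and_integral_eq i k
  have hle (i : Fin n) (k : ℕ) (hk : 1 ≤ k) (θ : S) := hbound i k hk θ.1 θ.2 (κ θ) (hκ θ)
  -- Divergence and determinacy use only this weaker, linear rate.
  have hgrowth (i : Fin n) (k : ℕ) (hk : 1 ≤ k) :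
      (C i * F.growth k) ^ (2 * k) ≤ (C i * k) ^ (2 * k) := by
    have h1 := (F.growth_pos hk).le
    have h2 := F.growth_le hk
    have h3 := (hC i).le
    gcongr
  refine ⟨C, hC, fun i k hk θ => ⟨(hmom i k θ).1, (hmom i k θ).2, hle i k hk θ⟩, fun φ hφ => ?_⟩
  have hmix (i : Fin n) (k : ℕ) (hk : 1 ≤ k) :=
    MixtureCarleman.integrable_mixture_and_integral_le (κ := κ) (φ := φ)
      (f := fun x => x i ^ (2 * k)) (by fun_prop) (fun x => (even_two_mul k).pow_nonneg _)
      ((even_two_mul k).pow_nonneg (C i * F.growth k)) (fun θ => (hmom i k θ).1)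
      (fun θ => (hmom i k θ).2.trans_le (hle i k hk θ))
  refine ⟨fun p hp i => ⟨fun k hk => ?_, ?_⟩, ?_⟩
  · rw [hp.riesz_eq hS]
    exact (hmix i k hk).2
  · refine MixtureCarleman.tsum_ofReal_rpow_neg_eq_top (hC i) fun k => ?_
    rw [hp.riesz_eq hS]
    simpa using (hmix i (k + 1) (by omega)).2.trans (hgrowth i (k + 1) (by omega))
  · exact MixtureCarleman.momentDeterminate_of_moment_le hC (fun i k hk => (hmix i k hk).1)
      fun i k hk => (hmix i k hk).2.trans (hgrowth i k hk)
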